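/- Let $n\ge 1$, $k\ge 0$ be integers and $\kappa,\rho>0$. Index vectors and matrices from $0$. **FFT prefix-sum mechanism.** Let $A\in\mathbb R^{n\times n}$ be the prefix-sum matrix (ones on and below the diagonal). Let $v=(1,\dots,1,0,\dots,0)$ with $n$ ones and $n$ zeros, let $A_{\rm circ}\in\mathbb R^{2n\times 2n}$ be the circulant matrix with first column $v$, let $\hat v_r=\sum_{a=0}^{2n-1}v_a e^{-2\pi \mathrm i ra/(2n)}$ be the discrete Fourier transform of $v$, let $F=\frac1{\sqrt{2n}}\big(e^{-2\pi \mathrm i ra/(2n)}\big)_{r,a}$, and let $\Sigma=\mathrm{diag}(\hat v)$, with $\Sigma^{1/2}$ the entrywise principal square root of the diagonal. On input $x\in\mathbb R^n$ the mechanism outputs $$\Big(\sum_{a\le i}x_a+\mathrm{Re}\,\tilde z_i\Big)_{0\le i<n},\qquad \tilde z=\sqrt{\frac{\kappa^2\|\hat v\|_1}{4n\rho}}\;F^*\Sigma^{1/2}w ,$$ where $w\in\mathbb C^{2n}$ is a standard complex normal vector: the real and imaginary parts of all its entries are independent $N(0,1)$ variables. **Neighbouring streams.** Let $\Pi$ be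 a participation schema, i.e. a set of subsets (participation patterns) of $\{0,\dots,n-1\}$. Streams $x,x'\in\mathbb R^n$ are neighbouring if there is $\pi\in\Pi$ with $x_i=x'_i$ for $i\notin\pi$ and $|x_i-x'_i|\le\kappa$ for $i\in\pi$. **Adaptive streams.** An adaptive stream is a family of measurable functions giving the entry $x_i$ in terms of the outputs released on steps $0,\dots,i-1$; the mechanism is run on it step by step, step $i$ releasing $\sum_{a\le i}x_a+\mathrm{Re}\,\tilde z_i$. Two adaptive streams are neighbouring if for every sequence of released outputs the two resulting streams are neighbouring. **zCDP.** A mechanism $M$ is $\rho'$-zCDP if for all neighbouring inputs $x,x'$ and all $\alpha\in(1,\infty)$ the Rényi divergence satisfies $D_\alpha(M(x)\,\|\,M(x'))\le\rho'\alpha$. **Theorem.** Suppose that every $\pi\in\Pi$ has at most $k$ elements (at most $k$ participations). One has $A_{\rm circ}=(F^*\Sigma^{1/2})(\Sigma^{1/2}F)$, and the upper left $n\times n$ block of $A_{\rm circ}$ is $A$. The FFT prefix-sum mechanism is $(k^2\rho)$-zCDP, both for streams fixed in advance and when run on adaptively chosen streams, where the output is the whole sequence of released values. -/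

import Mathlib

open MeasureTheory ProbabilityTheory

namespace FFTPrefixSum

noncomputable section

/-! ### Rényi divergence and zero-concentrated differential privacy -/

/-- The Rényi divergence `D_α(P ‖ Q) = (α - 1)⁻¹ log ∫ (dP/dQ)^α dQ` of order `α > 1`,
with value `+∞` when `P` is not absolutely continuous with respect to `Q`. -/
def renyiDiv {Ω : Type*} [MeasurableSpace Ω] (α : ℝ) (P Q : Measure Ω) : EReal :=
  open scoped Classical in
  if P ≪ Q then
    (((α - 1)⁻¹ : ℝ) : EReal) * ENNReal.log (∫⁻ ω, (P.rnDeriv Q ω) ^ α ∂Q)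
  else ⊤

/-- A mechanism `M`, given by the law `M x` of its output on each input `x`, is `ρ`-zCDP with
respect to a neighbouring relation on inputs if `D_α(M x ‖ M x') ≤ ρ α` for all neighbouring
`x, x'` and all `α ∈ (1, ∞)`. -/
def IsZCDP {D Ω : Type*} [MeasurableSpace Ω] (Neighbor : D → D → Prop) (M : D → Measure Ω)
    (ρ : ℝ) : Prop :=
  ∀ x x' : D, Neighbor x x' → ∀ α : ℝ, 1 < α → renyiDiv α (M x) (M x') ≤ ((ρ * α : ℝ) : EReal)

/-! ### Streams, participation schemas, neighbouring streams -/

/-- Two streams are neighbouring for the participation schema `Π` and the per-step bound `κ` if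
they differ only on the steps of one participation pattern of `Π`, by at most `κ` on each step. -/
def NeighboringStreams {n : ℕ} (Pi : Set (Finset (Fin n))) (κ : ℝ) (x x' : Fin n → ℝ) : Prop :=
  ∃ π ∈ Pi, (∀ i ∉ π, x i = x' i) ∧ ∀ i ∈ π, |x i - x' i| ≤ κ

/-- An adaptively chosen stream: the entry of step `i` is a measurable function of the outputs
that the mechanism has released on the steps before `i`. -/
structure AdaptiveStream (n : ℕ) where
  entry : (i : Fin n) → (Fin i → ℝ) → ℝ
  measurable_entry : ∀ i, Measurable (entry i)

/-- The stream that results from an adaptive choice when the released outputs are `y`. -/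
def AdaptiveStream.streamOn {n : ℕ} (a : AdaptiveStream n) (y : Fin n → ℝ) : Fin n → ℝ :=
  fun i => a.entry i (fun l => y ⟨l, l.2.trans i.2⟩)

/-- Two adaptive streams are neighbouring if, whatever outputs are released, the resulting
streams are neighbouring. -/
def NeighboringAdaptiveStreams {n : ℕ} (Pi : Set (Finset (Fin n))) (κ : ℝ)
    (a a' : AdaptiveStream n) : Prop :=
  ∀ y : Fin n → ℝ, NeighboringStreams Pi κ (a.streamOn y) (a'.streamOn y)

/-! ### The prefix-sum matrix, its circulant embedding, and the Fourier transform -/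

/-- The prefix-sum matrix: ones on and below the diagonal. -/
def prefixSumMatrix (n : ℕ) : Matrix (Fin n) (Fin n) ℝ :=
  Matrix.of fun i j => if j ≤ i then 1 else 0

/-- The vector `v = (1, …, 1, 0, …, 0)` with `n` ones and `n` zeros. -/
def embVec (n : ℕ) : Fin (2 * n) → ℝ := fun a => if (a : ℕ) < n then 1 else 0

/-- The inclusion of the first `n` indices. -/
def firstHalf {n : ℕ} (i : Fin n) : Fin (2 * n) := Fin.castLE (by omega) i

/-- The circulant matrix with first column `v`. -/
def circMatrix (n : ℕ) : Matrix (Fin (2 * n)) (Fin (2 * n)) ℝ := Matrix.circulant (embVec n)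

/-- The (unnormalised) discrete Fourier transform of `v`. -/
def vDFT (n : ℕ) (k : Fin (2 * n)) : ℂ :=
  ∑ a : Fin (2 * n),
    (embVec n a : ℂ) * Complex.exp (-(Complex.I * 2 * Real.pi * (k : ℕ) * (a : ℕ)) / (2 * n))

/-- The unitary DFT matrix `F` in dimension `2n`. -/
def dftMatrix (n : ℕ) : Matrix (Fin (2 * n)) (Fin (2 * n)) ℂ :=
  Matrix.of fun k a =>
    ((1 / Real.sqrt (2 * n) : ℝ) : ℂ) *
      Complex.exp (-(Complex.I * 2 * Real.pi * (k : ℕ) * (a : ℕ)) / (2 * n))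

/-- `Σ^{1/2}` for `Σ = diag(DFT v)`, with the principal square root (which is `0` at `0`). -/
def sqrtSigma (n : ℕ) : Matrix (Fin (2 * n)) (Fin (2 * n)) ℂ :=
  Matrix.diagonal fun k => vDFT n k ^ (1 / 2 : ℂ)

/-- The factor (decoder) `F* Σ^{1/2}`. -/
def decoder (n : ℕ) : Matrix (Fin (2 * n)) (Fin (2 * n)) ℂ :=
  (dftMatrix n).conjTranspose * sqrtSigma n

/-- The factor (encoder) `Σ^{1/2} F`. -/
def encoder (n : ℕ) : Matrix (Fin (2 * n)) (Fin (2 * n)) ℂ := sqrtSigma n * dftMatrix n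

/-! ### The mechanism -/

/-- The standard complex normal law on `ℂ`: independent `N(0,1)` real and imaginary parts. -/
def stdComplexNormal : Measure ℂ :=
  ((gaussianReal 0 1).prod (gaussianReal 0 1)).map Complex.measurableEquivRealProd.symm

/-- The law of a standard complex normal vector of length `2n`. -/
def stdComplexNormalVec (n : ℕ) : Measure (Fin (2 * n) → ℂ) :=
  Measure.pi fun _ => stdComplexNormal

/-- The noise scale `√(κ² ‖DFT v‖₁ / (4 n ρ))`. -/
def noiseScale (n : ℕ) (κ ρ : ℝ) : ℝ :=
  Real.sqrt (κ ^ 2 * (∑ k : Fin (2 * n), ‖vDFT n k‖) / (4 * n * ρ))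

/-- The noise added to the prefix sums, as a function of the complex vector `w`: the real part of
the first `n` coordinates of `√(κ² ‖DFT v‖₁ / (4 n ρ)) · F* Σ^{1/2} w`. -/
def fftNoise (n : ℕ) (κ ρ : ℝ) (w : Fin (2 * n) → ℂ) : Fin n → ℝ :=
  fun i => ((noiseScale n κ ρ : ℂ) * (decoder n).mulVec w (firstHalf i)).re

/-- The law of the output of the FFT prefix-sum mechanism on the stream `x`. -/
def fftMechanism (n : ℕ) (κ ρ : ℝ) (x : Fin n → ℝ) : Measure (Fin n → ℝ) :=
  (stdComplexNormalVec n).map fun w i => (∑ a ∈ Finset.Iic i, x a) + fftNoise n κ ρ w i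

/-- The outputs released in the interaction with an adaptive stream when the noise is `z`: on
step `i` the prefix sum of the entries chosen on the steps `0, …, i`, plus `z i`; the entry of
step `j` is chosen on the basis of the outputs of the steps before `j`. -/
def transcript {n : ℕ} (a : AdaptiveStream n) (z : Fin n → ℝ) (i : Fin n) : ℝ :=
  (∑ j : Fin ((i : ℕ) + 1),
    a.entry ⟨j, by omega⟩ (fun l : Fin (j : ℕ) => transcript a z ⟨l, by omega⟩)) + z i
termination_by (i : ℕ)
decreasing_by
  have h1 := j.2
  have h2 := l.2
  omega

/-- The law of all outputs of the FFT prefix-sum mechanism when it is run, step by step, on an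
adaptively chosen stream. -/
def adaptiveFFTMechanism (n : ℕ) (κ ρ : ℝ) (a : AdaptiveStream n) : Measure (Fin n → ℝ) :=
  (stdComplexNormalVec n).map fun w => transcript a (fftNoise n κ ρ w)

end

end FFTPrefixSum

/-!
The noise law of the mechanism is the image of a standard Gaussian measure under a surjective linear
map `A`, so it has density `exp (-‖B z‖² / 2)` with respect to an additive Haar measure, where `B z`
is the preimage of `z` under `A` of least norm. Even when the stream is chosen adaptively, the
released outputs `y` determine the noise as `y - prefixSum y`, and this is a strictly triangular
shear, hence preserves the Haar measure: the transcript of `a` has density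
`p_a y = exp (-‖B (y - a.prefixSum y)‖² / 2)`. Completing the square gives, pointwise in `y`,
`(p_a / p_a')^α p_a' = exp (α (α - 1) / 2 * ‖B (a.prefixSum y - a'.prefixSum y)‖²) p_b`,
where `b = α a + (1 - α) a'` is again an adaptive stream, so that `p_b` has total mass `1`. This
reduces the claim to the non-adaptive estimate `‖s‖² ≤ 2 k² ρ` for some preimage `s` of the prefix
sums of `δ = x - x'`. Since decoder times encoder is the prefix-sum matrix on the first `n` indices,
`s = c⁻¹ • encoder δ` is one, `c` being the noise scale, and the estimate holds because all entries
of row `r` of the encoder have squared modulus `‖v̂ r‖ / (2 n)`.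
-/

namespace FFTPrefixSum

open scoped RealInnerProductSpace

section Renyi

variable {Ω : Type*} [MeasurableSpace Ω] {α : ℝ}

lemma renyiDiv_withDensity_self {Q : Measure Ω} [SigmaFinite Q] {h : Ω → ENNReal}
    (hh : Measurable h) :
    renyiDiv α (Q.withDensity h) Q =
      (((α - 1)⁻¹ : ℝ) : EReal) * ENNReal.log (∫⁻ ω, h ω ^ α ∂Q) := by
  rw [renyiDiv, if_pos (withDensity_absolutelyContinuous Q h)]
  congr 2
  refine lintegral_congr_ae ?_
  filter_upwards [Measure.rnDeriv_withDensity Q hh] with ω hω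
  rw [hω]

lemma renyiDiv_withDensity_le {μ : Measure Ω} {f g : Ω → ℝ} (hf : Measurable f)
    (hg : Measurable g) (hf0 : ∀ x, 0 ≤ f x) (hg0 : ∀ x, 0 < g x)
    [SigmaFinite (μ.withDensity fun x => ENNReal.ofReal (g x))] (hα : 1 < α) {r : ℝ}
    (h : ∫⁻ x, ENNReal.ofReal ((f x / g x) ^ α * g x) ∂μ ≤
      ENNReal.ofReal (Real.exp ((α - 1) * r))) :
    renyiDiv α (μ.withDensity fun x => ENNReal.ofReal (f x))
      (μ.withDensity fun x => ENNReal.ofReal (g x)) ≤ (r : EReal) := by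
  set Q := μ.withDensity fun x => ENNReal.ofReal (g x) with hQ
  have ratio_withDensity : μ.withDensity (fun x => ENNReal.ofReal (f x)) =
      Q.withDensity fun x => ENNReal.ofReal (f x / g x) := by
    rw [hQ, ← withDensity_mul _ (by fun_prop) (by fun_prop)]
    congr with x
    rw [Pi.mul_apply, ← ENNReal.ofReal_mul (hg0 x).le, mul_div_cancel₀ _ (hg0 x).ne']
  have lintegral_ratio : ∫⁻ x, ENNReal.ofReal (f x / g x) ^ α ∂Q =
      ∫⁻ x, ENNReal.ofReal ((f x / g x) ^ α * g x) ∂μ := by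
    rw [hQ, lintegral_withDensity_eq_lintegral_mul _ (by fun_prop) (by fun_prop)]
    refine lintegral_congr fun x => ?_
    rw [Pi.mul_apply, ENNReal.ofReal_rpow_of_nonneg (div_nonneg (hf0 x) (hg0 x).le) (by linarith),
      ← ENNReal.ofReal_mul (hg0 x).le, mul_comm]
  have hα0 : 0 < α - 1 := sub_pos.2 hα
  rw [ratio_withDensity, renyiDiv_withDensity_self (by fun_prop), lintegral_ratio]
  calc (((α - 1)⁻¹ : ℝ) : EReal) * ENNReal.log (∫⁻ x, ENNReal.ofReal ((f x / g x) ^ α * g x) ∂μ)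
      ≤ ((α - 1)⁻¹ : ℝ) * ENNReal.log (ENNReal.ofReal (Real.exp ((α - 1) * r))) :=
        mul_le_mul_of_nonneg_left (ENNReal.log_le_log h)
          (EReal.coe_nonneg.2 (inv_nonneg.2 hα0.le))
    _ = r := by
        rw [ENNReal.log_ofReal_of_pos (Real.exp_pos _), Real.log_exp, ← EReal.coe_mul,
          inv_mul_cancel_left₀ hα0.ne']

end Renyi

lemma map_withDensity_comp {α β : Type*} [MeasurableSpace α] [MeasurableSpace β] {μ : Measure α}
    {T : α → β} {g : β → ENNReal} (hT : Measurable T) (hg : Measurable g) :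
    (μ.withDensity fun a => g (T a)).map T = (μ.map T).withDensity g := by
  ext s hs
  rw [Measure.map_apply hT hs, withDensity_apply _ (hT hs), withDensity_apply _ hs,
    setLIntegral_map hs hg hT]

section StdGaussian

variable {E : Type*} [NormedAddCommGroup E] [InnerProductSpace ℝ E] [FiniteDimensional ℝ E]
  [MeasurableSpace E] [BorelSpace E]

lemma integral_exp_neg_sq_norm_smul_cexp_inner (t : E) :
    ∫ x : E, Real.exp (-‖x‖ ^ 2 / 2) • Complex.exp (⟪x, t⟫ * Complex.I) =
      ((2 * Real.pi) ^ (Module.finrank ℝ E / 2 : ℝ) : ℝ) • Complex.exp (-‖t‖ ^ 2 / 2) := by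
  have h := GaussianFourier.integral_cexp_neg_mul_sq_norm_add (b := 1 / 2) (by norm_num) Complex.I t
  convert h using 2
  · ext x
    rw [Complex.real_smul, Complex.ofReal_exp, ← Complex.exp_add, real_inner_comm]
    push_cast
    ring_nf
  · rw [Complex.real_smul, Complex.ofReal_cpow (by positivity), Complex.I_sq]
    push_cast
    ring_nf

lemma stdGaussian_eq_smul_withDensity :
    stdGaussian E = ENNReal.ofReal ((2 * Real.pi) ^ (-(Module.finrank ℝ E / 2) : ℝ)) •
      volume.withDensity fun x => ENNReal.ofReal (Real.exp (-‖x‖ ^ 2 / 2)) := by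
  have h2π : 0 < 2 * Real.pi := by positivity
  have : IsFiniteMeasure (volume.withDensity fun x : E =>
      ENNReal.ofReal (Real.exp (-‖x‖ ^ 2 / 2))) := by
    refine isFiniteMeasure_withDensity_ofReal (Integrable.hasFiniteIntegral ?_)
    refine .of_integral_ne_zero ?_
    have h := GaussianFourier.integral_rexp_neg_mul_sq_norm (V := E) (b := 1 / 2) (by norm_num)
    ring_nf at h ⊢
    rw [h]
    positivity
  have : IsFiniteMeasure (ENNReal.ofReal ((2 * Real.pi) ^ (-(Module.finrank ℝ E / 2) : ℝ)) •
      volume.withDensity fun x : E => ENNReal.ofReal (Real.exp (-‖x‖ ^ 2 / 2))) :=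
    Measure.smul_finite _ ENNReal.ofReal_ne_top
  refine Measure.ext_of_charFun (funext fun t => ?_)
  rw [charFun_stdGaussian, charFun_apply, integral_smul_measure,
    integral_withDensity_eq_integral_toReal_smul (by fun_prop) (by simp),
    ENNReal.toReal_ofReal (by positivity)]
  simp_rw [ENNReal.toReal_ofReal (Real.exp_nonneg _)]
  rw [integral_exp_neg_sq_norm_smul_cexp_inner, smul_smul, ← Real.rpow_add h2π, neg_add_cancel,
    Real.rpow_zero, one_smul]

lemma map_orthogonalProjectionOnto_stdGaussian (K : Submodule ℝ E) :
    (stdGaussian E).map K.orthogonalProjectionOnto = stdGaussian K := by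
  refine Measure.ext_of_charFun (funext fun t => ?_)
  rw [charFun_stdGaussian, charFun_apply, integral_map (by fun_prop) (by fun_prop)]
  simp_rw [K.inner_orthogonalProjectionOnto_eq_of_mem_right]
  rw [← charFun_apply, charFun_stdGaussian, Submodule.coe_norm]

lemma map_pi_stdGaussian {ι : Type*} [Fintype ι] :
    (Measure.pi fun _ : ι => stdGaussian E).map (WithLp.toLp 2) =
      stdGaussian (PiLp 2 fun _ : ι => E) := by
  refine Measure.ext_of_charFun (funext fun t => ?_)
  simp_rw [charFun_pi, charFun_stdGaussian, ← Complex.exp_sum, ← Complex.ofReal_pow,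
    PiLp.norm_sq_eq_of_L2]
  rw [Complex.ofReal_sum, ← Finset.sum_neg_distrib, Finset.sum_div]

lemma exists_isAddHaarMeasure_stdGaussian_eq :
    ∃ μ : Measure E, μ.IsAddHaarMeasure ∧
      stdGaussian E = μ.withDensity fun x => ENNReal.ofReal (Real.exp (-‖x‖ ^ 2 / 2)) := by
  refine ⟨_, .smul volume (ENNReal.ofReal_pos.2 ?_).ne' ENNReal.ofReal_ne_top,
    stdGaussian_eq_smul_withDensity.trans (withDensity_smul_measure _ _).symm⟩
  positivity

lemma exists_map_stdGaussian_eq_withDensity {F : Type*} [NormedAddCommGroup F] [NormedSpace ℝ F]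
    [MeasurableSpace F] [BorelSpace F] {A : E →L[ℝ] F} (hA : Function.Surjective A) :
    ∃ μ : Measure F, μ.IsAddHaarMeasure ∧ ∃ B : F →L[ℝ] E, (∀ h, ‖B (A h)‖ ≤ ‖h‖) ∧
      (stdGaussian E).map A =
        μ.withDensity fun z => ENNReal.ofReal (Real.exp (-‖B z‖ ^ 2 / 2)) := by
  let K := A.kerᗮ
  have apply_proj (h : E) : A (K.orthogonalProjectionOnto h) = A h := by
    have := K.sub_starProjection_mem_orthogonal h
    rw [Submodule.orthogonal_orthogonal, LinearMap.mem_ker, map_sub, sub_eq_zero] at this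
    exact this.symm
  have injective : Function.Injective (A.toLinearMap ∘ₗ K.subtype) := by
    rw [← LinearMap.ker_eq_bot, LinearMap.ker_comp, ← Submodule.disjoint_iff_comap_eq_bot]
    exact A.ker.orthogonal_disjoint.symm
  have surjective : Function.Surjective (A.toLinearMap ∘ₗ K.subtype) :=
    hA.forall.2 fun h => ⟨K.orthogonalProjectionOnto h, apply_proj h⟩
  let e : K ≃L[ℝ] F := (LinearEquiv.ofBijective _ ⟨injective, surjective⟩).toContinuousLinearEquiv
  have e_proj (h : E) : e (K.orthogonalProjectionOnto h) = A h := apply_proj h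
  obtain ⟨μ, hμ, hK⟩ := exists_isAddHaarMeasure_stdGaussian_eq (E := K)
  refine ⟨μ.map e, e.isAddHaarMeasure_map μ, K.subtypeL ∘L e.symm, fun h => ?_, ?_⟩
  · rw [← e_proj]
    simpa using K.norm_orthogonalProjectionOnto_apply_le h
  · have hmap : (stdGaussian E).map A = (stdGaussian K).map e := by
      rw [← map_orthogonalProjectionOnto_stdGaussian, Measure.map_map (by fun_prop) (by fun_prop)]
      exact congrArg (Measure.map · _) (funext fun h => (e_proj h).symm)
    rw [hmap, hK, ← map_withDensity_comp (by fun_prop) (by fun_prop)]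
    simp

end StdGaussian

lemma measurePreserving_add_of_dependsOn_Iio {G : Type*} [AddGroup G] [MeasurableSpace G]
    [MeasurableAdd₂ G] {μ : Measure G} [SigmaFinite μ] [μ.IsAddLeftInvariant] {n : ℕ}
    {g : (Fin n → G) → Fin n → G} (hg : Measurable g)
    (hdep : ∀ i, DependsOn (fun y => g y i) (Set.Iio i)) :
    MeasurePreserving (fun y => g y + y) (Measure.pi fun _ => μ) (Measure.pi fun _ => μ) := by
  induction n with
  | zero =>
    rw [show (fun y => g y + y) = id from Subsingleton.elim _ _]
    exact .id _
  | succ n ih =>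
    let e := MeasurableEquiv.piFinSuccAbove (fun _ => G) (Fin.last n)
    have he : MeasurePreserving e (Measure.pi fun _ => μ) (μ.prod (Measure.pi fun _ => μ)) :=
      measurePreserving_piFinSuccAbove (fun _ => μ) (Fin.last n)
    -- `g` does not depend on the last coordinate, which may therefore be filled in with `0`.
    let extend (x : Fin n → G) : Fin (n + 1) → G := e.symm (0, x)
    have extend_castSucc (x : Fin n → G) (i : Fin n) : extend x i.castSucc = x i := by
      simp [extend, e]
    have apply_extend (y : Fin (n + 1) → G) (i : Fin (n + 1)) :
        g (extend (e y).2) i = g y i :=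
      hdep i fun j hj => by
        obtain ⟨j, rfl⟩ := Fin.exists_castSucc_eq.2 (ne_of_lt (hj.trans_le (Fin.le_last i)))
        rw [extend_castSucc]
        simp [e, Fin.init]
    have measurable_extend : Measurable extend := e.symm.measurable.comp measurable_prodMk_left
    have init_preserving := ih (g := fun x i => g (extend x) i.castSucc) (by fun_prop)
      fun i x x' h => hdep _ fun j hj => by
        obtain ⟨j, rfl⟩ := Fin.exists_castSucc_eq.2 (ne_of_lt (hj.trans_le (Fin.le_last _)))
        simpa only [extend_castSucc] using h j hj
    have skew_preserving := init_preserving.skew_product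
      (g := fun x c => g (extend x) (Fin.last n) + c) (μc := μ) (μd := μ) (by fun_prop)
      (.of_forall fun x => map_add_left_eq_self μ _)
    refine (he.comp_left_iff).1 ?_
    convert (Measure.measurePreserving_swap.comp skew_preserving).comp
      (Measure.measurePreserving_swap.comp he) using 1
    ext y i
    · simp [e, ← apply_extend y]
    · simp [e, ← apply_extend y, Fin.init]

namespace AdaptiveStream

variable {n : ℕ}

/-- The prefix sums of the stream that results from the released outputs `y`. -/
def prefixSum (a : AdaptiveStream n) (y : Fin n → ℝ) : Fin n → ℝ :=
  fun i => ∑ j ∈ Finset.Iic i, a.streamOn y j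

lemma dependsOn_prefixSum (a : AdaptiveStream n) (i : Fin n) :
    DependsOn (fun y => a.prefixSum y i) (Set.Iio i) := fun _ _ h =>
  Finset.sum_congr rfl fun _ hj => congrArg (a.entry _) <| funext fun l =>
    h _ (Fin.mk_lt_of_lt_val (l.2.trans_le (Fin.le_def.1 (Finset.mem_Iic.1 hj))))

@[fun_prop]
lemma measurable_prefixSum (a : AdaptiveStream n) : Measurable a.prefixSum :=
  measurable_pi_lambda _ fun _ => Finset.measurable_sum _ fun j _ =>
    (a.measurable_entry j).comp (by fun_prop)

lemma transcript_eq (a : AdaptiveStream n) (z : Fin n → ℝ) :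
    transcript a z = a.prefixSum (transcript a z) + z := by
  ext i
  rw [transcript, Pi.add_apply, prefixSum, add_left_inj]
  refine Finset.sum_nbij (fun j => ⟨j, by omega⟩) (fun j _ => ?_) (fun j _ j' _ h => ?_)
    (fun j hj => ⟨⟨j, ?_⟩, Finset.mem_coe.2 (Finset.mem_univ _), rfl⟩) fun _ _ => rfl
  · simpa [Fin.le_def] using Nat.lt_succ_iff.1 j.2
  · simpa [Fin.ext_iff] using h
  · exact Nat.lt_succ_iff.2 (Fin.le_def.1 (Finset.mem_Iic.1 (Finset.mem_coe.1 hj)))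

lemma transcript_sub_prefixSum (a : AdaptiveStream n) (y : Fin n → ℝ) :
    transcript a (y - a.prefixSum y) = y := by
  ext i
  induction i using WellFoundedLT.induction with
  | ind i ih =>
    rw [transcript_eq, Pi.add_apply, Pi.sub_apply]
    exact (congrArg (· + _) (a.dependsOn_prefixSum i ih)).trans (add_sub_cancel _ _)

@[fun_prop]
lemma measurable_transcript (a : AdaptiveStream n) : Measurable (transcript a) := by
  refine measurable_pi_iff.2 fun i => ?_
  induction i using WellFoundedLT.induction with
  | ind i ih =>
    unfold transcript
    refine .add (Finset.measurable_sum _ fun j _ => ?_) (measurable_pi_apply i)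
    exact (a.measurable_entry _).comp (measurable_pi_lambda _ fun l => ih _
      (Fin.mk_lt_of_lt_val (l.2.trans_le (Nat.lt_succ_iff.1 j.2))))

lemma measurePreserving_transcript (a : AdaptiveStream n) (μ : Measure (Fin n → ℝ))
    [μ.IsAddHaarMeasure] : MeasurePreserving (transcript a) μ μ := by
  have shear : MeasurePreserving (fun y => -a.prefixSum y + y) volume volume :=
    measurePreserving_add_of_dependsOn_Iio (by fun_prop) fun i _ _ h =>
      congrArg Neg.neg (a.dependsOn_prefixSum i h)
  have inverse : transcript a ∘ (fun y => -a.prefixSum y + y) = id :=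
    funext fun y => by rw [Function.comp_apply, neg_add_eq_sub, transcript_sub_prefixSum, id]
  have volume_preserving : MeasurePreserving (transcript a) volume volume := by
    have := (inverse ▸ MeasurePreserving.id _ :
      MeasurePreserving (transcript a ∘ fun y => -a.prefixSum y + y) volume volume).map_of_comp
        a.measurable_transcript shear.measurable
    rwa [shear.map_eq] at this
  rw [Measure.isAddLeftInvariant_eq_smul μ volume]
  exact volume_preserving.smul_measure _

lemma map_transcript_withDensity (a : AdaptiveStream n) {μ : Measure (Fin n → ℝ)}
    [μ.IsAddHaarMeasure] {f : (Fin n → ℝ) → ENNReal} (hf : Measurable f) :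
    (μ.withDensity f).map (transcript a) = μ.withDensity fun y => f (y - a.prefixSum y) := by
  have noise_eq (z : Fin n → ℝ) : z = transcript a z - a.prefixSum (transcript a z) :=
    eq_sub_of_add_eq' (a.transcript_eq z).symm
  conv_rhs => rw [← (a.measurePreserving_transcript μ).map_eq]
  rw [← map_withDensity_comp (by fun_prop) (by fun_prop)]
  simp_rw [← noise_eq]

/-- The affine combination `α a + (1 - α) a'` of adaptive streams. -/
def affineComb (α : ℝ) (a a' : AdaptiveStream n) : AdaptiveStream n where
  entry i y := α * a.entry i y + (1 - α) * a'.entry i y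
  measurable_entry i := ((a.measurable_entry i).const_mul α).add
    ((a'.measurable_entry i).const_mul (1 - α))

lemma prefixSum_affineComb (α : ℝ) (a a' : AdaptiveStream n) (y : Fin n → ℝ) :
    (affineComb α a a').prefixSum y = α • a.prefixSum y + (1 - α) • a'.prefixSum y := by
  ext i
  simp only [prefixSum, streamOn, affineComb, Finset.sum_add_distrib, ← Finset.mul_sum,
    Pi.add_apply, Pi.smul_apply, smul_eq_mul]

end AdaptiveStream

section GaussianNoise

variable {E : Type*} [NormedAddCommGroup E] [InnerProductSpace ℝ E] {n : ℕ}

lemma exp_neg_sq_norm_div_rpow_mul (α : ℝ) (u u' : E) :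
    (Real.exp (-‖u‖ ^ 2 / 2) / Real.exp (-‖u'‖ ^ 2 / 2)) ^ α * Real.exp (-‖u'‖ ^ 2 / 2) =
      Real.exp (α * (α - 1) / 2 * ‖u - u'‖ ^ 2) *
        Real.exp (-‖α • u + (1 - α) • u'‖ ^ 2 / 2) := by
  rw [← Real.exp_sub, ← Real.exp_mul, ← Real.exp_add, ← Real.exp_add, norm_sub_sq_real,
    norm_add_sq_real, norm_smul, norm_smul, mul_pow, mul_pow, Real.norm_eq_abs, Real.norm_eq_abs,
    sq_abs, sq_abs, real_inner_smul_left, real_inner_smul_right]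
  ring_nf

/-- The density of the transcript of `a` when the noise `z` has the density `exp (-‖B z‖² / 2)`. The
normalising constant is absorbed into the reference measure. -/
noncomputable def AdaptiveStream.gaussianDensity (B : (Fin n → ℝ) →L[ℝ] E) (a : AdaptiveStream n)
    (y : Fin n → ℝ) : ℝ :=
  Real.exp (-‖B (y - a.prefixSum y)‖ ^ 2 / 2)

lemma AdaptiveStream.gaussianDensity_div_rpow_mul (B : (Fin n → ℝ) →L[ℝ] E)
    (a a' : AdaptiveStream n) (α : ℝ) (y : Fin n → ℝ) :
    (a.gaussianDensity B y / a'.gaussianDensity B y) ^ α * a'.gaussianDensity B y =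
      Real.exp (α * (α - 1) / 2 * ‖B (a.prefixSum y - a'.prefixSum y)‖ ^ 2) *
        (affineComb α a a').gaussianDensity B y := by
  have sub_eq : B (y - a.prefixSum y) - B (y - a'.prefixSum y) =
      -B (a.prefixSum y - a'.prefixSum y) := by
    rw [← map_sub, ← map_neg]
    congr 1
    abel
  have comb_eq : α • B (y - a.prefixSum y) + (1 - α) • B (y - a'.prefixSum y) =
      B (y - (affineComb α a a').prefixSum y) := by
    rw [← map_smul, ← map_smul, ← map_add, prefixSum_affineComb]
    congr 1
    module
  simp only [gaussianDensity]
  rw [exp_neg_sq_norm_div_rpow_mul, sub_eq, comb_eq, norm_neg]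

variable [MeasurableSpace E] [BorelSpace E]

@[fun_prop]
lemma AdaptiveStream.measurable_gaussianDensity (B : (Fin n → ℝ) →L[ℝ] E) (a : AdaptiveStream n) :
    Measurable (a.gaussianDensity B) := by
  unfold gaussianDensity
  fun_prop

variable [FiniteDimensional ℝ E]

theorem renyiDiv_map_transcript_le {A : E →L[ℝ] (Fin n → ℝ)} (hA : Function.Surjective A)
    {a a' : AdaptiveStream n} {R α : ℝ} (hα : 1 < α)
    (hshift : ∀ y, ∃ s, A s = a.prefixSum y - a'.prefixSum y ∧ ‖s‖ ^ 2 ≤ 2 * R) :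
    renyiDiv α (((stdGaussian E).map A).map (transcript a))
      (((stdGaussian E).map A).map (transcript a')) ≤ ((R * α : ℝ) : EReal) := by
  obtain ⟨μ, _, B, hB, hμ⟩ := exists_map_stdGaussian_eq_withDensity hA
  have law_eq (b : AdaptiveStream n) : ((stdGaussian E).map A).map (transcript b) =
      μ.withDensity fun y => ENNReal.ofReal (b.gaussianDensity B y) := by
    rw [hμ, b.map_transcript_withDensity (by fun_prop)]
    rfl
  have isProbability (b : AdaptiveStream n) : IsProbabilityMeasure
      (μ.withDensity fun y => ENNReal.ofReal (b.gaussianDensity B y)) := by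
    have := Measure.isProbabilityMeasure_map (μ := stdGaussian E) A.measurable.aemeasurable
    rw [← law_eq]
    exact Measure.isProbabilityMeasure_map b.measurable_transcript.aemeasurable
  let b := AdaptiveStream.affineComb α a a'
  have ratio_le (y : Fin n → ℝ) :
      (a.gaussianDensity B y / a'.gaussianDensity B y) ^ α * a'.gaussianDensity B y ≤
        Real.exp ((α - 1) * (R * α)) * b.gaussianDensity B y := by
    obtain ⟨s, hs, hsR⟩ := hshift y
    have hBs : ‖B (A s)‖ ^ 2 ≤ 2 * R := (pow_le_pow_left₀ (norm_nonneg _) (hB s) 2).trans hsR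
    rw [AdaptiveStream.gaussianDensity_div_rpow_mul, ← hs]
    refine mul_le_mul_of_nonneg_right (Real.exp_le_exp.2 ?_) (Real.exp_pos _).le
    nlinarith [mul_pos (zero_lt_one.trans hα) (sub_pos.2 hα)]
  rw [law_eq, law_eq]
  refine renyiDiv_withDensity_le (by fun_prop) (by fun_prop) (fun _ => (Real.exp_pos _).le)
    (fun _ => Real.exp_pos _) hα ?_
  calc ∫⁻ y, ENNReal.ofReal
          ((a.gaussianDensity B y / a'.gaussianDensity B y) ^ α * a'.gaussianDensity B y) ∂μ
      ≤ ∫⁻ y, ENNReal.ofReal (Real.exp ((α - 1) * (R * α))) *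
          ENNReal.ofReal (b.gaussianDensity B y) ∂μ := lintegral_mono fun y => by
        rw [← ENNReal.ofReal_mul (Real.exp_pos _).le]
        exact ENNReal.ofReal_le_ofReal (ratio_le y)
    _ = ENNReal.ofReal (Real.exp ((α - 1) * (R * α))) := by
        rw [lintegral_const_mul _ (by fun_prop), ← setLIntegral_univ,
          ← withDensity_apply _ .univ, measure_univ, mul_one]

end GaussianNoise

section Fourier

open scoped Matrix Fin.CommRing

/-- The unnormalised matrix of the discrete Fourier transform of length `N`. -/
noncomputable def fourierMatrix (N : ℕ) : Matrix (Fin N) (Fin N) ℂ :=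
  Matrix.of fun r a => Complex.exp (-(Complex.I * 2 * Real.pi * (r : ℕ) * (a : ℕ)) / N)

variable {N : ℕ} [NeZero N]

lemma fourierMatrix_apply_eq_stdAddChar (r a : Fin N) :
    fourierMatrix N r a = ZMod.stdAddChar (-(ZMod.finEquiv N r * ZMod.finEquiv N a)) := by
  have finEquiv_eq (b : Fin N) : ZMod.finEquiv N b = ((b : ℕ) : ℤ) := by
    rw [Int.cast_natCast, ← map_natCast (ZMod.finEquiv N), Fin.cast_val_eq_self]
  rw [finEquiv_eq, finEquiv_eq, ← Int.cast_mul, ← Int.cast_neg, ZMod.stdAddChar_coe, fourierMatrix,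
    Matrix.of_apply]
  congr 1
  push_cast
  ring

lemma sum_star_fourierMatrix_mul_mul (a b c : Fin N) :
    ∑ r, star (fourierMatrix N r a) * fourierMatrix N r c * fourierMatrix N r b =
      if c = a - b then (N : ℂ) else 0 := by
  let φ := ZMod.finEquiv N
  calc ∑ r, star (fourierMatrix N r a) * fourierMatrix N r c * fourierMatrix N r b
      = ∑ r, ZMod.stdAddChar (φ r * φ (a - b - c)) := by
        refine Finset.sum_congr rfl fun r _ => ?_
        simp only [fourierMatrix_apply_eq_stdAddChar, RCLike.star_def, ← AddChar.map_neg_eq_conj,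
          ← AddChar.map_add_eq_mul, map_sub]
        congr 1
        ring
    _ = ∑ x : ZMod N, ZMod.stdAddChar (x * φ (a - b - c)) :=
        φ.toEquiv.sum_comp fun x => ZMod.stdAddChar (x * φ (a - b - c))
    _ = if c = a - b then (N : ℂ) else 0 := by
        simp only [AddChar.sum_mulShift _ (ZMod.isPrimitive_stdAddChar N),
          map_eq_zero_iff φ φ.injective, sub_eq_zero, eq_comm, ZMod.card, Nat.cast_ite,
          Nat.cast_zero]

theorem conjTranspose_mul_diagonal_mul_fourierMatrix (v : Fin N → ℂ) :
    (fourierMatrix N)ᴴ * Matrix.diagonal (fourierMatrix N *ᵥ v) * fourierMatrix N =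
      (N : ℂ) • Matrix.circulant v := by
  ext a b
  calc ((fourierMatrix N)ᴴ * Matrix.diagonal (fourierMatrix N *ᵥ v) * fourierMatrix N) a b
      = ∑ c, (∑ r, star (fourierMatrix N r a) * fourierMatrix N r c * fourierMatrix N r b) *
          v c := by
        rw [Matrix.mul_apply]
        simp only [Matrix.mul_diagonal, Matrix.conjTranspose_apply, Matrix.mulVec, dotProduct,
          Finset.mul_sum, Finset.sum_mul]
        rw [Finset.sum_comm]
        refine Finset.sum_congr rfl fun c _ => Finset.sum_congr rfl fun r _ => ?_
        ring
    _ = ((N : ℂ) • Matrix.circulant v) a b := by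
        simp only [sum_star_fourierMatrix_mul_mul, ite_mul, zero_mul, Finset.sum_ite_eq',
          Finset.mem_univ, if_true, Matrix.smul_apply, Matrix.circulant_apply, smul_eq_mul]

end Fourier

section CirculantFactorization

open scoped Matrix

lemma dftMatrix_eq_smul_fourierMatrix (n : ℕ) :
    dftMatrix n = ((1 / Real.sqrt (2 * n) : ℝ) : ℂ) • fourierMatrix (2 * n) := by
  ext r a
  simp [dftMatrix, fourierMatrix]

lemma vDFT_eq_fourierMatrix_mulVec (n : ℕ) :
    vDFT n = fourierMatrix (2 * n) *ᵥ (Complex.ofReal ∘ embVec n) := by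
  ext r
  simp [vDFT, fourierMatrix, Matrix.mulVec, dotProduct, mul_comm]

lemma sqrtSigma_mul_self (n : ℕ) : sqrtSigma n * sqrtSigma n = Matrix.diagonal (vDFT n) := by
  rw [sqrtSigma, Matrix.diagonal_mul_diagonal]
  congr 1
  ext r
  rw [← sq, one_div]
  exact Complex.cpow_nat_inv_pow _ two_ne_zero

theorem circMatrix_map_eq_decoder_mul_encoder {n : ℕ} (hn : 0 < n) :
    (circMatrix n).map Complex.ofReal = decoder n * encoder n := by
  have : NeZero (2 * n) := ⟨by omega⟩
  have hnorm : ((1 / Real.sqrt (2 * n) : ℝ) : ℂ) * ((1 / Real.sqrt (2 * n) : ℝ) : ℂ) *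
      ((2 * n : ℕ) : ℂ) = 1 := by
    rw [← Complex.ofReal_mul, div_mul_div_comm, Real.mul_self_sqrt (by positivity)]
    have : (n : ℂ) ≠ 0 := Nat.cast_ne_zero.2 hn.ne'
    push_cast
    field_simp
  calc (circMatrix n).map Complex.ofReal
      = Matrix.circulant (Complex.ofReal ∘ embVec n) := Matrix.map_circulant _ _
    _ = (dftMatrix n)ᴴ * Matrix.diagonal (vDFT n) * dftMatrix n := by
        rw [dftMatrix_eq_smul_fourierMatrix, vDFT_eq_fourierMatrix_mulVec,
          Matrix.conjTranspose_smul, Complex.star_def, Complex.conj_ofReal, Matrix.smul_mul,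
          Matrix.smul_mul, Matrix.mul_smul, conjTranspose_mul_diagonal_mul_fourierMatrix, smul_smul,
          smul_smul, hnorm, one_smul]
    _ = decoder n * encoder n := by
        rw [← sqrtSigma_mul_self, decoder, encoder]
        simp only [Matrix.mul_assoc]

theorem circMatrix_submatrix_firstHalf (n : ℕ) :
    (circMatrix n).submatrix firstHalf firstHalf = prefixSumMatrix n := by
  ext i j
  have hij : ((firstHalf i - firstHalf j : Fin (2 * n)) : ℕ) < n ↔ j ≤ i := by
    rw [Fin.val_sub, Fin.le_def]
    simp only [firstHalf, Fin.val_castLE]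
    rcases le_or_gt (j : ℕ) i with h | h
    · rw [show 2 * n - (j : ℕ) + i = (i - j) + 2 * n by omega, Nat.add_mod_right,
        Nat.mod_eq_of_lt (by omega)]
      omega
    · rw [Nat.mod_eq_of_lt (by omega)]
      omega
  simp only [circMatrix, prefixSumMatrix, Matrix.submatrix_apply, Matrix.circulant_apply, embVec,
    Matrix.of_apply, hij]

end CirculantFactorization

section Sensitivity

open scoped Matrix

lemma sum_norm_mulVec_sq_le {m ι R : Type*} [Fintype m] [Fintype ι] [NormedRing R]
    {M : Matrix m ι R} {c : m → ℝ} (hM : ∀ r j, ‖M r j‖ ^ 2 ≤ c r) (x : ι → R) :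
    ∑ r, ‖(M *ᵥ x) r‖ ^ 2 ≤ (∑ r, c r) * (∑ j, ‖x j‖) ^ 2 := by
  rw [Finset.sum_mul]
  refine Finset.sum_le_sum fun r _ => ?_
  rcases isEmpty_or_nonempty ι with h | ⟨⟨j₀⟩⟩
  · simp [Matrix.mulVec, dotProduct]
  have hr : 0 ≤ c r := (sq_nonneg _).trans (hM r j₀)
  calc ‖(M *ᵥ x) r‖ ^ 2 ≤ (∑ j, Real.sqrt (c r) * ‖x j‖) ^ 2 := by
        gcongr
        refine norm_sum_le_of_le _ fun j _ => (norm_mul_le _ _).trans ?_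
        gcongr
        exact Real.le_sqrt_of_sq_le (hM r j)
    _ = c r * (∑ j, ‖x j‖) ^ 2 := by rw [← Finset.mul_sum, mul_pow, Real.sq_sqrt hr]

lemma norm_fourierMatrix_apply {N : ℕ} (r a : Fin N) : ‖fourierMatrix N r a‖ = 1 := by
  have : NeZero N := ⟨r.pos.ne'⟩
  rw [fourierMatrix_apply_eq_stdAddChar, AddChar.norm_apply]

lemma norm_encoder_sq {n : ℕ} (r a : Fin (2 * n)) :
    ‖encoder n r a‖ ^ 2 = ‖vDFT n r‖ / (2 * n) := by
  have norm_sqrt_sq : ‖vDFT n r ^ (1 / 2 : ℂ)‖ ^ 2 = ‖vDFT n r‖ := by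
    rw [← norm_pow, one_div]
    exact congrArg norm (Complex.cpow_nat_inv_pow _ two_ne_zero)
  rw [encoder, sqrtSigma, Matrix.diagonal_mul, dftMatrix_eq_smul_fourierMatrix, Matrix.smul_apply,
    norm_mul, norm_smul, norm_fourierMatrix_apply, mul_one, mul_pow, norm_sqrt_sq,
    Complex.norm_real, Real.norm_eq_abs, sq_abs, div_pow, one_pow, Real.sq_sqrt (by positivity),
    mul_one_div]

lemma sum_abs_le_of_neighboringStreams {n : ℕ} {κ : ℝ} (hκ : 0 ≤ κ) {k : ℕ}
    {Pi : Set (Finset (Fin n))} (hPi : ∀ π ∈ Pi, π.card ≤ k) {x x' : Fin n → ℝ}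
    (h : NeighboringStreams Pi κ x x') : ∑ j, |x j - x' j| ≤ k * κ := by
  obtain ⟨π, hπ, eq_off, le_on⟩ := h
  calc ∑ j, |x j - x' j| = ∑ j ∈ π, |x j - x' j| :=
        (Finset.sum_subset (Finset.subset_univ π) fun j _ hj => by
          rw [eq_off j hj, sub_self, abs_zero]).symm
    _ ≤ π.card * κ := by simpa using Finset.sum_le_card_nsmul π _ κ le_on
    _ ≤ k * κ := by gcongr; exact hPi π hπ

end Sensitivity

section Noise

open scoped Matrix

lemma prefixSumMatrix_mulVec {n : ℕ} (x : Fin n → ℝ) :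
    prefixSumMatrix n *ᵥ x = fun i => ∑ j ∈ Finset.Iic i, x j := by
  ext i
  simp [prefixSumMatrix, Matrix.mulVec, dotProduct, ← Finset.sum_filter, Finset.filter_ge_eq_Iic]

lemma surjective_prefixSumMatrix_mulVec (n : ℕ) :
    Function.Surjective (prefixSumMatrix n *ᵥ ·) := by
  have lower : (prefixSumMatrix n).IsLowerTriangular := fun i j hij => by
    simpa [prefixSumMatrix] using hij
  rw [Matrix.mulVec_surjective_iff_isUnit, Matrix.isUnit_iff_isUnit_det,
    Matrix.det_of_isLowerTriangular _ lower]
  simp [prefixSumMatrix]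

lemma decoder_mul_encoder_submatrix_firstHalf {n : ℕ} (hn : 0 < n) :
    (decoder n).submatrix firstHalf id * (encoder n).submatrix id firstHalf =
      (prefixSumMatrix n).map Complex.ofReal := by
  rw [← Matrix.submatrix_mul _ _ _ _ _ Function.bijective_id,
    ← circMatrix_map_eq_decoder_mul_encoder hn, Matrix.submatrix_map,
    circMatrix_submatrix_firstHalf]

lemma sum_norm_vDFT_pos {n : ℕ} (hn : 0 < n) : 0 < ∑ r, ‖vDFT n r‖ := by
  refine (Finset.sum_nonneg fun _ _ => norm_nonneg _).lt_of_ne' fun h => ?_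
  have vDFT_eq_zero : vDFT n = 0 := by
    rw [Finset.sum_eq_zero_iff_of_nonneg fun _ _ => norm_nonneg _] at h
    exact funext fun r => norm_eq_zero.1 (h r (Finset.mem_univ r))
  have diag := congrFun₂ (decoder_mul_encoder_submatrix_firstHalf hn) ⟨0, hn⟩ ⟨0, hn⟩
  simp [encoder, sqrtSigma, vDFT_eq_zero, prefixSumMatrix, Matrix.mul_apply] at diag

lemma noiseScale_sq {n : ℕ} {κ ρ : ℝ} (hρ : 0 ≤ ρ) :
    noiseScale n κ ρ ^ 2 = κ ^ 2 * (∑ r, ‖vDFT n r‖) / (4 * n * ρ) :=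
  Real.sq_sqrt (by positivity)

lemma noiseScale_pos {n : ℕ} (hn : 0 < n) {κ ρ : ℝ} (hκ : 0 < κ) (hρ : 0 < ρ) :
    0 < noiseScale n κ ρ := by
  have := sum_norm_vDFT_pos hn
  exact Real.sqrt_pos.2 (by positivity)

/-- The noise of the mechanism as a real-linear map of `w`, where `w` carries the Euclidean norm of
`ℂ²ⁿ`. -/
noncomputable def noiseMap (n : ℕ) (κ ρ : ℝ) :
    PiLp 2 (fun _ : Fin (2 * n) => ℂ) →L[ℝ] (Fin n → ℝ) :=
  LinearMap.toContinuousLinearMap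
    { toFun := fun w => fftNoise n κ ρ w.ofLp
      map_add' := fun w w' => by
        ext i
        simp [fftNoise, Matrix.mulVec_add, mul_add]
      map_smul' := fun t w => by
        ext i
        simp [fftNoise, Matrix.mulVec_smul, mul_left_comm] }

/-- A vector whose image under `noiseMap` is the vector of prefix sums of `δ`: shifting `w` by it
has the same effect on the released outputs as adding `δ` to the stream. -/
noncomputable def streamShift (n : ℕ) (κ ρ : ℝ) (δ : Fin n → ℝ) :
    PiLp 2 (fun _ : Fin (2 * n) => ℂ) :=
  WithLp.toLp 2 <| (noiseScale n κ ρ : ℂ)⁻¹ •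
    ((encoder n).submatrix id firstHalf *ᵥ (Complex.ofReal ∘ δ))

variable {n : ℕ} {κ ρ : ℝ}

lemma noiseMap_streamShift (hn : 0 < n) (hκ : 0 < κ) (hρ : 0 < ρ) (δ : Fin n → ℝ) :
    noiseMap n κ ρ (streamShift n κ ρ δ) = prefixSumMatrix n *ᵥ δ := by
  have hc : (noiseScale n κ ρ : ℂ) ≠ 0 :=
    Complex.ofReal_ne_zero.2 (noiseScale_pos hn hκ hρ).ne'
  have decode : (decoder n).submatrix firstHalf id *ᵥ
      ((encoder n).submatrix id firstHalf *ᵥ (Complex.ofReal ∘ δ)) =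
        Complex.ofReal ∘ (prefixSumMatrix n *ᵥ δ) := by
    rw [Matrix.mulVec_mulVec, decoder_mul_encoder_submatrix_firstHalf hn]
    ext i
    exact (RingHom.map_mulVec Complex.ofRealHom _ _ i).symm
  ext i
  calc noiseMap n κ ρ (streamShift n κ ρ δ) i
      = (((decoder n).submatrix firstHalf id *ᵥ
          ((encoder n).submatrix id firstHalf *ᵥ (Complex.ofReal ∘ δ))) i).re := by
        change (_ * (decoder n *ᵥ (_ • _)) _).re = _
        rw [Matrix.mulVec_smul, Pi.smul_apply, smul_eq_mul, mul_inv_cancel_left₀ hc]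
        rfl
    _ = (prefixSumMatrix n *ᵥ δ) i := by rw [decode]; rfl

lemma surjective_noiseMap (hn : 0 < n) (hκ : 0 < κ) (hρ : 0 < ρ) :
    Function.Surjective (noiseMap n κ ρ) := fun t => by
  obtain ⟨δ, rfl⟩ := surjective_prefixSumMatrix_mulVec n t
  exact ⟨_, noiseMap_streamShift hn hκ hρ δ⟩

lemma norm_streamShift_sq_le (hn : 0 < n) (hκ : 0 < κ) (hρ : 0 < ρ) (δ : Fin n → ℝ) :
    ‖streamShift n κ ρ δ‖ ^ 2 ≤ 2 * ρ / κ ^ 2 * (∑ j, |δ j|) ^ 2 := by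
  have hV := sum_norm_vDFT_pos hn
  have sensitivity : ∑ r, ‖((encoder n).submatrix id firstHalf *ᵥ (Complex.ofReal ∘ δ)) r‖ ^ 2 ≤
      (∑ r, ‖vDFT n r‖ / (2 * n)) * (∑ j, |δ j|) ^ 2 := by
    simpa using sum_norm_mulVec_sq_le (M := (encoder n).submatrix id firstHalf)
      (fun r j => (norm_encoder_sq r (firstHalf j)).le) (Complex.ofReal ∘ δ)
  calc ‖streamShift n κ ρ δ‖ ^ 2
      = (noiseScale n κ ρ ^ 2)⁻¹ *
          ∑ r, ‖((encoder n).submatrix id firstHalf *ᵥ (Complex.ofReal ∘ δ)) r‖ ^ 2 := by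
        rw [streamShift, PiLp.norm_sq_eq_of_L2, Finset.mul_sum]
        simp only [Pi.smul_apply, norm_smul, mul_pow, norm_inv, inv_pow, Complex.norm_real,
          Real.norm_eq_abs, sq_abs]
    _ ≤ (noiseScale n κ ρ ^ 2)⁻¹ * ((∑ r, ‖vDFT n r‖ / (2 * n)) * (∑ j, |δ j|) ^ 2) := by gcongr
    _ = 2 * ρ / κ ^ 2 * (∑ j, |δ j|) ^ 2 := by
        rw [noiseScale_sq hρ.le, ← Finset.sum_div]
        field_simp
        ring

end Noise

section Mechanism

lemma stdComplexNormal_eq_stdGaussian : stdComplexNormal = stdGaussian ℂ := by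
  rw [stdComplexNormal, ← (measurePreserving_finTwoArrow (gaussianReal 0 1)).map_eq,
    stdGaussian_eq_map_pi_orthonormalBasis Complex.orthonormalBasisOneI,
    Measure.map_map (by fun_prop) (by fun_prop)]
  refine congrArg (Measure.map · _) (funext fun x => ?_)
  simp [Complex.ext_iff, Complex.orthonormalBasisOneI]

lemma map_toLp_stdComplexNormalVec (n : ℕ) : (stdComplexNormalVec n).map (WithLp.toLp 2) =
    stdGaussian (PiLp 2 fun _ : Fin (2 * n) => ℂ) := by
  rw [stdComplexNormalVec, stdComplexNormal_eq_stdGaussian, map_pi_stdGaussian]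

lemma adaptiveFFTMechanism_eq_map_transcript (n : ℕ) (κ ρ : ℝ) (a : AdaptiveStream n) :
    adaptiveFFTMechanism n κ ρ a =
      ((stdGaussian _).map (noiseMap n κ ρ)).map (transcript a) := by
  rw [← map_toLp_stdComplexNormalVec, Measure.map_map (by fun_prop) (by fun_prop),
    Measure.map_map (by fun_prop) (by fun_prop)]
  rfl

theorem isZCDP_adaptiveFFTMechanism {n : ℕ} (hn : 0 < n) {κ ρ : ℝ} (hκ : 0 < κ) (hρ : 0 < ρ)
    {k : ℕ} {Pi : Set (Finset (Fin n))} (hPi : ∀ π ∈ Pi, π.card ≤ k) :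
    IsZCDP (NeighboringAdaptiveStreams Pi κ) (adaptiveFFTMechanism n κ ρ) ((k : ℝ) ^ 2 * ρ) := by
  intro a a' haa' α hα
  rw [adaptiveFFTMechanism_eq_map_transcript, adaptiveFFTMechanism_eq_map_transcript]
  refine renyiDiv_map_transcript_le (surjective_noiseMap hn hκ hρ) hα fun y => ?_
  let δ := a.streamOn y - a'.streamOn y
  refine ⟨streamShift n κ ρ δ, ?_, ?_⟩
  · rw [noiseMap_streamShift hn hκ hρ, Matrix.mulVec_sub, prefixSumMatrix_mulVec,
      prefixSumMatrix_mulVec]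
    rfl
  · calc ‖streamShift n κ ρ δ‖ ^ 2 ≤ 2 * ρ / κ ^ 2 * (∑ j, |δ j|) ^ 2 :=
          norm_streamShift_sq_le hn hκ hρ δ
      _ ≤ 2 * ρ / κ ^ 2 * (k * κ) ^ 2 := by
          gcongr
          exact sum_abs_le_of_neighboringStreams hκ.le hPi (haa' y)
      _ = 2 * ((k : ℝ) ^ 2 * ρ) := by field_simp

/-- A stream that is fixed in advance, as an adaptive stream. -/
def AdaptiveStream.const {n : ℕ} (x : Fin n → ℝ) : AdaptiveStream n where
  entry i _ := x i
  measurable_entry _ := measurable_const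

lemma fftMechanism_eq_adaptiveFFTMechanism_const (n : ℕ) (κ ρ : ℝ) (x : Fin n → ℝ) :
    fftMechanism n κ ρ x = adaptiveFFTMechanism n κ ρ (.const x) := by
  rw [fftMechanism, adaptiveFFTMechanism]
  congr with w
  rw [AdaptiveStream.transcript_eq]
  rfl

theorem isZCDP_fftMechanism {n : ℕ} (hn : 0 < n) {κ ρ : ℝ} (hκ : 0 < κ) (hρ : 0 < ρ)
    {k : ℕ} {Pi : Set (Finset (Fin n))} (hPi : ∀ π ∈ Pi, π.card ≤ k) :
    IsZCDP (NeighboringStreams Pi κ) (fftMechanism n κ ρ) ((k : ℝ) ^ 2 * ρ) := by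
  intro x x' hxx' α hα
  rw [fftMechanism_eq_adaptiveFFTMechanism_const, fftMechanism_eq_adaptiveFFTMechanism_const]
  exact isZCDP_adaptiveFFTMechanism hn hκ hρ hPi (.const x) (.const x') (fun _ => hxx') α hα

end Mechanism

end FFTPrefixSum

theorem mainTheorem7 (n : ℕ) (hn : 0 < n) (κ ρ : ℝ) (hκ : 0 < κ) (hρ : 0 < ρ) (k : ℕ)
    (Pi : Set (Finset (Fin n))) (hPi : ∀ π ∈ Pi, π.card ≤ k) :
    (FFTPrefixSum.circMatrix n).map Complex.ofReal =
        FFTPrefixSum.decoder n * FFTPrefixSum.encoder n ∧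
      (FFTPrefixSum.circMatrix n).submatrix FFTPrefixSum.firstHalf FFTPrefixSum.firstHalf =
        FFTPrefixSum.prefixSumMatrix n ∧
      FFTPrefixSum.IsZCDP (FFTPrefixSum.NeighboringStreams Pi κ)
        (FFTPrefixSum.fftMechanism n κ ρ) ((k : ℝ) ^ 2 * ρ) ∧
      FFTPrefixSum.IsZCDP (FFTPrefixSum.NeighboringAdaptiveStreams Pi κ)
        (FFTPrefixSum.adaptiveFFTMechanism n κ ρ) ((k : ℝ) ^ 2 * ρ) :=
  ⟨FFTPrefixSum.circMatrix_map_eq_decoder_mul_encoder hn,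
    FFTPrefixSum.circMatrix_submatrix_firstHalf n,
    FFTPrefixSum.isZCDP_fftMechanism hn hκ hρ hPi,
    FFTPrefixSum.isZCDP_adaptiveFFTMechanism hn hκ hρ hPi⟩
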